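/- A partition $\lambda$ of a nonnegative integer is a weakly decreasing finite sequence $\lambda_1\ge\lambda_2\ge\cdots\ge\lambda_\ell$ of positive integers (possibly empty); write $|\lambda|=\lambda_1+\cdots+\lambda_\ell$ for its size and $\sharp(\lambda)=\ell$ for its number of parts. Say that $\lambda$ is of Type I if $\lambda_i-\lambda_{i+2}\ge 3$ for all $1\le i\le \ell-2$, and, for all $1\le i\le \ell-1$, $\lambda_i-\lambda_{i+1}\le 1$ implies $\lambda_i+\lambda_{i+1}\equiv 0\pmod 3$. For $s\in\{1,2,3\}$ let $$G_s(x,q)=\sum_{\lambda}x^{\sharp(\lambda)}q^{|\lambda|},$$ where the sum is over all Type I partitions $\lambda$ all of whose parts are at least $s$ (the empty partition included). Let $(a;q)_n=\prod_{k=0}^{n-1}(1-aq^k)$. Then, as formal power series in $x$ and $q$, $$G_1(x,q)=\sum_{n_1,n_2\ge 0}\frac{q^{n_1^2+3n_2^2+3n_1n_2}\,x^{n_1+2n_2}}{(q;q)_{n_1}(q^3;q^3)_{n_2}},$$ $$G_2(x,q)=\sum_{n_1,n_2\ge 0}\frac{q^{n_1^2+3n_2^2+3n_1n_2+n_1+3n_2}\,x^{n_1+2n_2}}{(q;q)_{n_1}(q^3;q^3)_{n_2}},$$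 $$G_3(x,q)=\sum_{n_1,n_2\ge 0}\frac{q^{n_1^2+3n_2^2+3n_1n_2+2n_1+3n_2}\,x^{n_1+2n_2}}{(q;q)_{n_1}(q^3;q^3)_{n_2}}.$$ -/

import Mathlib

open PowerSeries
open scoped PowerSeries.WithPiTopology

/-- A partition of some nonnegative integer: `⟨n, p⟩` with `p` a partition of `n`.
The unique partition of `0` is the empty partition. -/
abbrev IntPartition : Type := Σ n : ℕ, n.Partition

namespace IntPartition

/-- The sum `|λ|` of all parts. -/
def size (l : IntPartition) : ℕ := l.1

/-- The number `♯(λ)` of parts. -/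
def numParts (l : IntPartition) : ℕ := Multiset.card l.2.parts

/-- The parts `λ₁ ≥ λ₂ ≥ ⋯ ≥ λ_ℓ` as a weakly decreasing list. -/
def partsList (l : IntPartition) : List ℕ := l.2.parts.sort (· ≥ ·)

/-- Difference at least `d` at distance `k`: `λ_j - λ_{j+k} ≥ d` for all `j`. -/
def DiffAtDistance (d k : ℕ) (l : IntPartition) : Prop :=
  ∀ (j : ℕ) (h : j + k < l.partsList.length),
    l.partsList[j + k] + d ≤ l.partsList[j]

/-- Partitions of type I: difference at least `3` at distance `2`, and if two consecutive parts
differ by at most `1`, then their sum is divisible by `3`. -/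
def IsTypeI (l : IntPartition) : Prop :=
  l.DiffAtDistance 3 2 ∧
    ∀ (j : ℕ) (h : j + 1 < l.partsList.length),
      l.partsList[j] ≤ l.partsList[j + 1] + 1 → 3 ∣ l.partsList[j] + l.partsList[j + 1]

/-- The partitions of type I whose parts are all at least `s`
(the empty partition is included). -/
def typeI (s : ℕ) : Set IntPartition :=
  {l | l.IsTypeI ∧ ∀ a ∈ l.2.parts, s ≤ a}

/-- The generating function `G_S(x, q) = ∑_{λ ∈ S} x^{♯(λ)} q^{|λ|}` of a set `S` of partitions, as a
formal power series in `x` whose coefficients are formal power series in `q`: the coefficient of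
`x^m q^n` is the number of partitions of `n` in `S` with exactly `m` parts. -/
noncomputable def genFun (S : Set IntPartition) : ℤ⟦X⟧⟦X⟧ :=
  PowerSeries.mk fun m => PowerSeries.mk fun n =>
    (({l : IntPartition | l ∈ S ∧ l.numParts = m ∧ l.size = n}.ncard : ℕ) : ℤ)

end IntPartition

/-- The `q`-Pochhammer symbol `(a; q)_n = ∏_{k=0}^{n-1} (1 - a q^k)`. -/
def qPochhammer {R : Type*} [CommRing R] (a q : R) (n : ℕ) : R :=
  ∏ k ∈ Finset.range n, (1 - a * q ^ k)

/-- `1 / ((q; q)_{n₁} (q³; q³)_{n₂})` as a formal power series in `q`. -/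
noncomputable def recipDenom (n₁ n₂ : ℕ) : ℤ⟦X⟧ :=
  PowerSeries.invOfUnit (qPochhammer X X n₁ * qPochhammer (X ^ 3) (X ^ 3) n₂) 1

/-- `recipDenom` really is the multiplicative inverse of the denominator. -/
theorem denom_mul_recipDenom (n₁ n₂ : ℕ) :
    (qPochhammer X X n₁ * qPochhammer (X ^ 3) (X ^ 3) n₂ : ℤ⟦X⟧) * recipDenom n₁ n₂ = 1 := by
  apply PowerSeries.mul_invOfUnit
  simp [qPochhammer, map_prod]

/-- The summand `q^e x^{n₁ + 2 n₂} / ((q; q)_{n₁} (q³; q³)_{n₂})`, where the outer variable of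
`ℤ⟦X⟧⟦X⟧` is `x` and the inner one is `q`. -/
noncomputable def typeISummand (e n₁ n₂ : ℕ) : ℤ⟦X⟧⟦X⟧ :=
  PowerSeries.C ((X : ℤ⟦X⟧) ^ e * recipDenom n₁ n₂) * (X : ℤ⟦X⟧⟦X⟧) ^ (n₁ + 2 * n₂)

namespace IntPartition

theorem finite_fiber (S : Set IntPartition) (m n : ℕ) :
    {l : IntPartition | l ∈ S ∧ l.numParts = m ∧ l.size = n}.Finite := by
  refine (Set.finite_range (fun p : n.Partition => (⟨n, p⟩ : IntPartition))).subset ?_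
  rintro ⟨k, p⟩ ⟨-, -, h⟩
  obtain rfl : k = n := h
  exact ⟨p, rfl⟩

/-- `genFun S` is the sum of `x^{♯(λ)} q^{|λ|}` over `λ ∈ S`, in the topology of
coefficientwise convergence. -/
theorem hasSum_genFun (S : Set IntPartition) :
    HasSum (fun l : S => PowerSeries.C ((X : ℤ⟦X⟧) ^ (l : IntPartition).size) *
      (X : ℤ⟦X⟧⟦X⟧) ^ (l : IntPartition).numParts) (genFun S) := by
  rw [PowerSeries.WithPiTopology.hasSum_iff_hasSum_coeff]
  intro m
  rw [PowerSeries.WithPiTopology.hasSum_iff_hasSum_coeff]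
  intro n
  have hfin := finite_fiber S m n
  have hfin' : {l : S | (l : IntPartition).numParts = m ∧ (l : IntPartition).size = n}.Finite := by
    refine Set.Finite.of_finite_image (f := Subtype.val) (hfin.subset ?_)
      Subtype.val_injective.injOn
    rintro _ ⟨l, hl, rfl⟩
    exact ⟨l.2, hl⟩
  have key : ((genFun S).coeff m).coeff n = ∑ l ∈ hfin'.toFinset, ((PowerSeries.C
      ((X : ℤ⟦X⟧) ^ (l : IntPartition).size) *
      (X : ℤ⟦X⟧⟦X⟧) ^ (l : IntPartition).numParts).coeff m).coeff n := by
    rw [Finset.sum_congr rfl (g := fun _ => (1 : ℤ))]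
    · simp only [genFun, PowerSeries.coeff_mk, Finset.sum_const, nsmul_eq_mul, mul_one]
      rw [← Set.ncard_eq_toFinset_card _ hfin', ← Set.ncard_image_of_injective _
        (Subtype.val_injective : Function.Injective (Subtype.val : S → IntPartition))]
      congr 2
      ext l
      simp only [Set.mem_ofPred_eq, Set.mem_image, Subtype.exists, exists_and_left]
      grind
    · intro l hl
      have hl' := hfin'.mem_toFinset.mp hl
      simp only [Set.mem_ofPred_eq] at hl'
      rw [hl'.1, hl'.2, PowerSeries.coeff_C_mul, PowerSeries.coeff_X_pow, if_pos rfl, mul_one,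
        PowerSeries.coeff_X_pow, if_pos rfl]
  rw [key]
  apply hasSum_sum_of_ne_finset_zero
  intro l hl
  have hl' : ¬ ((l : IntPartition).numParts = m ∧ (l : IntPartition).size = n) := by
    simpa using hl
  rw [PowerSeries.coeff_C_mul, PowerSeries.coeff_X_pow]
  split_ifs with h
  · rw [mul_one, PowerSeries.coeff_X_pow, if_neg]
    exact fun h2 => hl' ⟨h.symm, h2.symm⟩
  · simp

end IntPartition

/-! ### Generating functions of sets of lists -/

namespace ListGenFun

/-! Both sides solve the same linear system of q-difference equations, whose solution is determined
by the coefficients of x^0. On the partition side, read the parts in increasing order and split off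
the smallest ones. The admissible remainders have parts at least 4, 5 or 6, and shifting all parts
by 3 preserves Type I, so G_{s+3}(x,q) = G_s(xq^3,q) and the system closes on G_1, G_2, G_3
(`isSolution_listGenFun`). On the series side, let S(a,b) be the double sum with linear exponent a
n₁ + b n₂. Then x ↦ xq^3 sends S(a,b) to S(a+3,b+6), and two contiguous relations give the same
system for S(0,0), S(1,3), S(2,3) (`isSolution_doubleSum`). For uniqueness (`IsSolution.unique`),
compare coefficients of x^m: adding the three equations leaves (1 - q^{3m}) f_m in terms of lower
coefficients. -/

theorem finite_length_sum (m n : ℕ) : {L : List ℕ | L.length = m ∧ L.sum = n}.Finite := by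
  refine ((List.finite_length_le (Fin (n + 1)) m).image (List.map Fin.val)).subset ?_
  rintro L ⟨hm, hn⟩
  have hle : ∀ a ∈ L, a < n + 1 := fun a ha => by
    have := List.single_le_sum (l := L) (fun _ _ => Nat.zero_le _) a ha
    omega
  refine ⟨L.pmap (fun a h => (⟨a, h⟩ : Fin (n + 1))) hle, by simp [hm], ?_⟩
  simp [List.map_pmap]

/-- The lists in `S` of length `m` and sum `n`. -/
def fiber (S : Set (List ℕ)) (m n : ℕ) : Set (List ℕ) :=
  {L | L ∈ S ∧ L.length = m ∧ L.sum = n}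

/-- Finiteness makes `Set.ncard` additive on disjoint unions. Fixing the length matters, since lists
may contain zeros. -/
theorem finite_fiber (S : Set (List ℕ)) (m n : ℕ) : (fiber S m n).Finite :=
  (finite_length_sum m n).subset fun _ h => h.2

/-- The generating function `∑_{L ∈ S} x^{length L} q^{sum L}`. -/
noncomputable def listGenFun (S : Set (List ℕ)) : ℤ⟦X⟧⟦X⟧ :=
  PowerSeries.mk fun m => PowerSeries.mk fun n => ((fiber S m n).ncard : ℤ)

theorem coeff_coeff_listGenFun (S : Set (List ℕ)) (m n : ℕ) :
    ((listGenFun S).coeff m).coeff n = ((fiber S m n).ncard : ℤ) := by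
  simp [listGenFun]

theorem listGenFun_union {S T : Set (List ℕ)} (h : Disjoint S T) :
    listGenFun (S ∪ T) = listGenFun S + listGenFun T := by
  ext m n
  simp only [map_add, coeff_coeff_listGenFun]
  have hU : fiber (S ∪ T) m n = fiber S m n ∪ fiber T m n := by
    ext L; simp only [fiber, Set.mem_union, Set.mem_ofPred_eq]; tauto
  rw [hU, Set.ncard_union_eq _ (finite_fiber _ _ _) (finite_fiber _ _ _)]
  · push_cast; rfl
  · exact h.mono (fun _ h => h.1) (fun _ h => h.1)

theorem listGenFun_image_cons (a : ℕ) (S : Set (List ℕ)) :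
    listGenFun (List.cons a '' S) = PowerSeries.C ((X : ℤ⟦X⟧) ^ a) * X * listGenFun S := by
  ext m n
  rw [mul_assoc, PowerSeries.coeff_C_mul, coeff_coeff_listGenFun]
  cases m with
  | zero =>
    rw [PowerSeries.coeff_zero_X_mul, mul_zero, map_zero]
    have : fiber (List.cons a '' S) 0 n = ∅ := by
      ext L; simp only [fiber, Set.mem_image, Set.mem_ofPred_eq]; grind
    simp [this]
  | succ m =>
    rw [PowerSeries.coeff_succ_X_mul, PowerSeries.coeff_X_pow_mul']
    split_ifs with h
    · rw [coeff_coeff_listGenFun,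
        ← Set.ncard_image_of_injective (fiber S m (n - a)) (List.cons_injective (a := a))]
      congr 2
      ext L; simp only [fiber, Set.mem_image, Set.mem_ofPred_eq]
      constructor
      · rintro ⟨⟨L, hL, rfl⟩, hm, hn⟩
        simp only [List.length_cons, List.sum_cons] at hm hn
        exact ⟨L, ⟨hL, by omega, by omega⟩, rfl⟩
      · rintro ⟨L, ⟨hL, hm, hn⟩, rfl⟩
        simp only [List.length_cons, List.sum_cons]
        exact ⟨⟨L, hL, rfl⟩, by omega, by omega⟩
    · have : fiber (List.cons a '' S) (m + 1) n = ∅ := by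
        ext L; simp only [fiber, Set.mem_image, Set.mem_ofPred_eq, Set.mem_empty_iff_false, iff_false]
        rintro ⟨⟨L, hL, rfl⟩, hm, hn⟩
        simp only [List.sum_cons] at hn
        omega
      simp [this]

theorem sum_map_add (d : ℕ) (L : List ℕ) : (L.map (· + d)).sum = L.sum + d * L.length := by
  induction L with
  | nil => simp
  | cons a L ih => simp only [List.map_cons, List.sum_cons, ih, List.length_cons]; ring

/-- Raising each of m entries by d adds dm to the sum, which is the substitution x ↦ xq^d. -/
theorem listGenFun_image_map_add (d : ℕ) (S : Set (List ℕ)) :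
    listGenFun (List.map (· + d) '' S) = PowerSeries.rescale ((X : ℤ⟦X⟧) ^ d) (listGenFun S) := by
  ext m n
  rw [PowerSeries.coeff_rescale, ← pow_mul, PowerSeries.coeff_X_pow_mul', coeff_coeff_listGenFun]
  split_ifs with h
  · rw [coeff_coeff_listGenFun, ← Set.ncard_image_of_injective (fiber S m (n - d * m))
      (List.map_injective_iff.mpr (add_left_injective d))]
    congr 2
    ext L; simp only [fiber, Set.mem_image, Set.mem_ofPred_eq]
    constructor
    · rintro ⟨⟨L, hL, rfl⟩, rfl, hn⟩
      rw [sum_map_add] at hn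
      exact ⟨L, ⟨hL, by simp, by simp only [List.length_map]; omega⟩, rfl⟩
    · rintro ⟨L, ⟨hL, rfl, hn⟩, rfl⟩
      exact ⟨⟨L, hL, rfl⟩, by simp, by rw [sum_map_add]; omega⟩
  · have : fiber (List.map (· + d) '' S) m n = ∅ := by
      ext L; simp only [fiber, Set.mem_image, Set.mem_ofPred_eq, Set.mem_empty_iff_false, iff_false]
      rintro ⟨⟨L, hL, rfl⟩, rfl, hn⟩
      rw [sum_map_add] at hn
      simp only [List.length_map] at h
      omega
    simp [this]

end ListGenFun

/-! ### Type I partitions as weakly increasing lists -/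

namespace TypeIList

open ListGenFun

/-- The conditions of type I for a list of parts in weakly increasing order. -/
def IsTypeIList : List ℕ → Prop
  | [] => True
  | a :: L => (∀ b ∈ L.head?, a ≤ b ∧ (b ≤ a + 1 → 3 ∣ a + b)) ∧
      (∀ c ∈ L.tail.head?, a + 3 ≤ c) ∧ IsTypeIList L

/-- The type I lists whose first entry, if any, is at least `s`. -/
def typeIList (s : ℕ) : Set (List ℕ) :=
  {L | IsTypeIList L ∧ ∀ a ∈ L.head?, s ≤ a}

/-- Differences are unchanged and the sum of two neighbours grows by 6, so its residue mod 3 is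
kept. -/
theorem isTypeIList_map_add_three (L : List ℕ) :
    IsTypeIList (L.map (· + 3)) ↔ IsTypeIList L := by
  induction L with
  | nil => simp [IsTypeIList]
  | cons a L ih =>
    simp only [List.map_cons, IsTypeIList, ih]
    rcases L with _ | ⟨b, _ | ⟨c, L⟩⟩ <;> simp <;> omega

theorem exists_map_add_eq (d : ℕ) (L : List ℕ) (h : ∀ a ∈ L, d ≤ a) :
    ∃ M : List ℕ, M.map (· + d) = L :=
  ⟨L.map (· - d), by
    rw [List.map_map]
    conv_rhs => rw [← List.map_id L]
    exact List.map_congr_left fun a ha => Nat.sub_add_cancel (h a ha)⟩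

theorem IsTypeIList.forall_le {L : List ℕ} (hL : IsTypeIList L) {s : ℕ}
    (hs : ∀ a ∈ L.head?, s ≤ a) : ∀ a ∈ L, s ≤ a := by
  induction L generalizing s with
  | nil => simp
  | cons a L ih =>
    have hsa : s ≤ a := hs a (by simp)
    intro b hb
    rcases List.mem_cons.mp hb with rfl | hb
    · exact hsa
    · exact ih hL.2.2 (fun c hc => hsa.trans (hL.1 c hc).1) b hb

theorem typeIList_add_three (s : ℕ) :
    typeIList (s + 3) = List.map (· + 3) '' typeIList s := by
  ext L
  constructor
  · rintro ⟨hL, hs⟩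
    obtain ⟨M, rfl⟩ := exists_map_add_eq 3 L
      fun a ha => (Nat.le_add_left 3 s).trans (hL.forall_le hs a ha)
    refine ⟨M, ⟨(isTypeIList_map_add_three M).mp hL, ?_⟩, rfl⟩
    cases M <;> simp_all
  · rintro ⟨M, ⟨hM, hs⟩, rfl⟩
    refine ⟨(isTypeIList_map_add_three M).mpr hM, ?_⟩
    cases M <;> simp_all

theorem listGenFun_typeIList_add_three (s : ℕ) :
    listGenFun (typeIList (s + 3)) =
      PowerSeries.rescale ((X : ℤ⟦X⟧) ^ 3) (listGenFun (typeIList s)) := by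
  rw [typeIList_add_three, listGenFun_image_map_add]

theorem nil_mem_typeIList (s : ℕ) : [] ∈ typeIList s := by simp [typeIList, IsTypeIList]

theorem cons_mem_typeIList {s a : ℕ} {L : List ℕ} :
    a :: L ∈ typeIList s ↔ s ≤ a ∧ (∀ b ∈ L.head?, a ≤ b ∧ (b ≤ a + 1 → 3 ∣ a + b)) ∧
      (∀ c ∈ L.tail.head?, a + 3 ≤ c) ∧ IsTypeIList L := by
  simp [typeIList, IsTypeIList]; tauto

theorem cons_mem_image_cons {a b : ℕ} {L : List ℕ} {S : Set (List ℕ)} :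
    a :: L ∈ List.cons b '' S ↔ a = b ∧ L ∈ S := by
  simp only [Set.mem_image, List.cons.injEq]
  grind

theorem nil_notMem_image_cons {b : ℕ} {S : Set (List ℕ)} : [] ∉ List.cons b '' S := by
  simp

/-- After a smallest part 1, the next part cannot be 1, since 1 + 1 is not divisible by 3; it may be
2, 3 or at least 4. After 1, 2 and after 1, 3 the third part is at least 4, and 3, 4 is excluded
because 3 + 4 = 7. -/
theorem typeIList_one : typeIList 1 = typeIList 2 ∪ (List.cons 1 '' typeIList 4 ∪
    (List.cons 1 '' (List.cons 3 '' typeIList 5) ∪ List.cons 1 '' (List.cons 2 '' typeIList 4))) := by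
  ext L
  rcases L with _ | ⟨a, _ | ⟨b, _ | ⟨c, L⟩⟩⟩ <;>
    simp [nil_mem_typeIList, cons_mem_typeIList, cons_mem_image_cons, IsTypeIList,
      -Set.mem_image] <;> grind

theorem typeIList_two : typeIList 2 = typeIList 3 ∪ List.cons 2 '' typeIList 4 := by
  ext L
  rcases L with _ | ⟨a, _ | ⟨b, _ | ⟨c, L⟩⟩⟩ <;>
    simp [nil_mem_typeIList, cons_mem_typeIList, cons_mem_image_cons, IsTypeIList,
      -Set.mem_image] <;> grind

/-- After a smallest part 3, a second 3 is allowed (3 + 3 = 6) and forces the third part to be at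
least 6; a 4 is excluded. -/
theorem typeIList_three : typeIList 3 = typeIList 4 ∪ (List.cons 3 '' typeIList 5 ∪
    List.cons 3 '' (List.cons 3 '' typeIList 6)) := by
  ext L
  rcases L with _ | ⟨a, _ | ⟨b, _ | ⟨c, L⟩⟩⟩ <;>
    simp [nil_mem_typeIList, cons_mem_typeIList, cons_mem_image_cons, IsTypeIList,
      -Set.mem_image] <;> grind

theorem listGenFun_typeIList_one : listGenFun (typeIList 1) = listGenFun (typeIList 2) +
    (PowerSeries.C ((X : ℤ⟦X⟧) ^ 1) * X * listGenFun (typeIList 4) +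
      (PowerSeries.C ((X : ℤ⟦X⟧) ^ 1) * X * (PowerSeries.C ((X : ℤ⟦X⟧) ^ 3) * X *
        listGenFun (typeIList 5)) +
      PowerSeries.C ((X : ℤ⟦X⟧) ^ 1) * X * (PowerSeries.C ((X : ℤ⟦X⟧) ^ 2) * X *
        listGenFun (typeIList 4)))) := by
  simp only [← listGenFun_image_cons]
  rw [typeIList_one, listGenFun_union, listGenFun_union, listGenFun_union]
  all_goals
    rw [Set.disjoint_left]
    rintro (_ | ⟨a, _ | ⟨b, L⟩⟩) <;>
      simp [nil_mem_typeIList, nil_notMem_image_cons, cons_mem_typeIList, cons_mem_image_cons, IsTypeIList,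
        -Set.mem_image] <;> grind

theorem listGenFun_typeIList_two : listGenFun (typeIList 2) = listGenFun (typeIList 3) +
    PowerSeries.C ((X : ℤ⟦X⟧) ^ 2) * X * listGenFun (typeIList 4) := by
  simp only [← listGenFun_image_cons]
  rw [typeIList_two, listGenFun_union]
  rw [Set.disjoint_left]
  rintro (_ | ⟨a, L⟩) <;>
    simp [nil_mem_typeIList, cons_mem_typeIList, cons_mem_image_cons, -Set.mem_image] <;> grind

theorem listGenFun_typeIList_three : listGenFun (typeIList 3) = listGenFun (typeIList 4) +
    (PowerSeries.C ((X : ℤ⟦X⟧) ^ 3) * X * listGenFun (typeIList 5) +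
      PowerSeries.C ((X : ℤ⟦X⟧) ^ 3) * X * (PowerSeries.C ((X : ℤ⟦X⟧) ^ 3) * X *
        listGenFun (typeIList 6))) := by
  simp only [← listGenFun_image_cons]
  rw [typeIList_three, listGenFun_union, listGenFun_union]
  all_goals
    rw [Set.disjoint_left]
    rintro (_ | ⟨a, _ | ⟨b, L⟩⟩) <;>
      simp [nil_mem_typeIList, nil_notMem_image_cons, cons_mem_typeIList, cons_mem_image_cons, IsTypeIList,
        -Set.mem_image] <;> grind

theorem coeff_zero_listGenFun_typeIList (s : ℕ) : (listGenFun (typeIList s)).coeff 0 = 1 := by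
  ext n
  rw [coeff_coeff_listGenFun, PowerSeries.coeff_one]
  split_ifs with h
  · have : fiber (typeIList s) 0 n = {[]} := by
      ext L
      simp only [fiber, Set.mem_ofPred_eq, Set.mem_singleton_iff, List.length_eq_zero_iff]
      constructor
      · exact fun h => h.2.1
      · rintro rfl
        exact ⟨nil_mem_typeIList s, rfl, by simp [h]⟩
    simp [this]
  · have : fiber (typeIList s) 0 n = ∅ := by
      ext L
      simp only [fiber, Set.mem_ofPred_eq, List.length_eq_zero_iff, Set.mem_empty_iff_false,
        iff_false]
      rintro ⟨-, rfl, h'⟩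
      exact h (by simpa using h'.symm)
    simp [this]

/-! ### Comparison with the partitions of type I -/

theorem isTypeIList_iff_getElem (L : List ℕ) : IsTypeIList L ↔ L.SortedLE ∧
    (∀ (j : ℕ) (h : j + 2 < L.length), L[j] + 3 ≤ L[j + 2]) ∧
    ∀ (j : ℕ) (h : j + 1 < L.length), L[j + 1] ≤ L[j] + 1 → 3 ∣ L[j] + L[j + 1] := by
  induction L with
  | nil => simp [IsTypeIList, List.sortedLE_iff_pairwise]
  | cons a L ih =>
    constructor
    · intro hL
      obtain ⟨h0, h2, h1⟩ := ih.mp hL.2.2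
      refine ⟨?_, ?_, ?_⟩
      · rw [List.sortedLE_iff_pairwise, List.pairwise_cons]
        exact ⟨hL.2.2.forall_le fun b hb => (hL.1 b hb).1, h0.pairwise⟩
      · rintro (_ | j) h
        · refine hL.2.1 _ ?_
          rcases L with _ | ⟨b, _ | ⟨c, L⟩⟩ <;> simp at h ⊢
        · exact h2 j (Nat.lt_of_succ_lt_succ h)
      · rintro (_ | j) h
        · refine (hL.1 _ ?_).2
          rcases L with _ | ⟨b, L⟩ <;> simp at h ⊢
        · exact h1 j (Nat.lt_of_succ_lt_succ h)
    · rintro ⟨h0, h2, h1⟩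
      rw [List.sortedLE_iff_pairwise, List.pairwise_cons] at h0
      refine ⟨?_, ?_, ih.mpr ⟨h0.2.sortedLE, fun j h => h2 (j + 1) (Nat.succ_lt_succ h),
        fun j h => h1 (j + 1) (Nat.succ_lt_succ h)⟩⟩
      · rcases L with _ | ⟨b, L⟩
        · simp
        · simpa using ⟨h0.1 b (by simp), h1 0 (by simp)⟩
      · rcases L with _ | ⟨b, _ | ⟨c, L⟩⟩
        · simp
        · simp
        · simpa using h2 0 (by simp)

theorem getElem_reverse_conditions_iff (L : List ℕ) :
    ((∀ (j : ℕ) (h : j + 2 < L.length), L[j + 2] + 3 ≤ L[j]) ∧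
      ∀ (j : ℕ) (h : j + 1 < L.length), L[j] ≤ L[j + 1] + 1 → 3 ∣ L[j] + L[j + 1]) ↔
    (∀ (j : ℕ) (h : j + 2 < L.reverse.length), L.reverse[j] + 3 ≤ L.reverse[j + 2]) ∧
      ∀ (j : ℕ) (h : j + 1 < L.reverse.length),
        L.reverse[j + 1] ≤ L.reverse[j] + 1 → 3 ∣ L.reverse[j] + L.reverse[j + 1] := by
  simp only [List.length_reverse, List.getElem_reverse]
  refine and_congr ⟨fun H j h => ?_, fun H j h => ?_⟩ ⟨fun H j h => ?_, fun H j h => ?_⟩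
  · have := H (L.length - 1 - (j + 2)) (by omega)
    simpa only [show L.length - 1 - (j + 2) + 2 = L.length - 1 - j by omega] using this
  · have := H (L.length - 1 - (j + 2)) (by omega)
    simpa only [show L.length - 1 - (L.length - 1 - (j + 2) + 2) = j by omega,
      show L.length - 1 - (L.length - 1 - (j + 2)) = j + 2 by omega] using this
  · have := H (L.length - 1 - (j + 1)) (by omega)
    simpa only [show L.length - 1 - (j + 1) + 1 = L.length - 1 - j by omega,
      add_comm L[L.length - 1 - j]] using this
  · have := H (L.length - 1 - (j + 1)) (by omega)
    simpa only [show L.length - 1 - (L.length - 1 - (j + 1) + 1) = j by omega,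
      show L.length - 1 - (L.length - 1 - (j + 1)) = j + 1 by omega, add_comm L[j + 1]]
      using this

theorem isTypeI_iff (l : IntPartition) : l.IsTypeI ↔ IsTypeIList l.partsList.reverse := by
  rw [isTypeIList_iff_getElem]
  have hs : l.partsList.reverse.SortedLE := by
    rw [List.sortedLE_iff_pairwise, List.pairwise_reverse]
    exact Multiset.pairwise_sort _ _
  rw [and_iff_right hs]
  unfold IntPartition.IsTypeI IntPartition.DiffAtDistance
  exact getElem_reverse_conditions_iff _

theorem coe_partsList_reverse (l : IntPartition) :
    (l.partsList.reverse : Multiset ℕ) = l.2.parts := by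
  rw [Multiset.coe_reverse, IntPartition.partsList, Multiset.sort_eq]

theorem length_partsList_reverse (l : IntPartition) :
    l.partsList.reverse.length = l.numParts := by
  rw [IntPartition.numParts, ← coe_partsList_reverse, Multiset.coe_card]

theorem sum_partsList_reverse (l : IntPartition) : l.partsList.reverse.sum = l.size := by
  rw [IntPartition.size, ← Multiset.sum_coe, coe_partsList_reverse, l.2.parts_sum]

theorem partsList_reverse_injective :
    Function.Injective fun l : IntPartition => l.partsList.reverse := by
  intro l l' h
  have hp : l.2.parts = l'.2.parts := by
    rw [← coe_partsList_reverse, ← coe_partsList_reverse]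
    exact congrArg _ h
  obtain ⟨n, p⟩ := l
  obtain ⟨n', p'⟩ := l'
  obtain rfl : n = n' := by rw [← p.parts_sum, ← p'.parts_sum]; exact congrArg _ hp
  exact congrArg (Sigma.mk n) (Nat.Partition.ext hp)

theorem exists_partsList_reverse_eq (L : List ℕ) (hs : L.SortedLE) (hpos : ∀ a ∈ L, 0 < a) :
    ∃ l : IntPartition, l.partsList.reverse = L := by
  refine ⟨⟨L.sum, ⟨(L : Multiset ℕ), fun h => hpos _ (by simpa using h), by simp⟩⟩, ?_⟩
  rw [List.reverse_eq_iff]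
  refine List.Perm.eq_of_pairwise (le := (· ≥ ·)) (fun _ _ _ _ h h' => le_antisymm h' h)
    (Multiset.pairwise_sort _ _) ?_ ?_
  · rw [List.pairwise_reverse]; exact hs.pairwise
  · rw [← Multiset.coe_eq_coe, IntPartition.partsList, Multiset.sort_eq, Multiset.coe_reverse]

theorem mem_typeI_iff {s : ℕ} {l : IntPartition} :
    l ∈ IntPartition.typeI s ↔ l.partsList.reverse ∈ typeIList s := by
  refine and_congr_right_iff.mpr ?_ |>.trans (and_congr_left' (isTypeI_iff l))
  intro h
  rw [isTypeI_iff] at h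
  rw [← coe_partsList_reverse]
  exact ⟨fun H a ha => H a (List.mem_of_mem_head? ha), fun H => h.forall_le H⟩

/-- Positivity of s rules out lists with zeros, which come from no partition. -/
theorem genFun_typeI {s : ℕ} (hs : 0 < s) :
    IntPartition.genFun (IntPartition.typeI s) = listGenFun (typeIList s) := by
  ext m n
  rw [coeff_coeff_listGenFun]
  simp only [IntPartition.genFun, PowerSeries.coeff_mk]
  rw [← Set.ncard_image_of_injective _ partsList_reverse_injective]
  congr 2
  ext L
  simp only [fiber, Set.mem_image, Set.mem_ofPred_eq]
  constructor
  · rintro ⟨l, ⟨hl, rfl, rfl⟩, rfl⟩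
    exact ⟨mem_typeI_iff.mp hl, length_partsList_reverse l, sum_partsList_reverse l⟩
  · rintro ⟨hL, rfl, rfl⟩
    obtain ⟨l, rfl⟩ := exists_partsList_reverse_eq L ((isTypeIList_iff_getElem L).mp hL.1).1
      fun a ha => hs.trans_le (hL.1.forall_le hL.2 a ha)
    exact ⟨l, ⟨mem_typeI_iff.mpr hL, (length_partsList_reverse l).symm,
      (sum_partsList_reverse l).symm⟩, rfl⟩

end TypeIList

/-! ### The double sums -/

namespace TypeISeries

theorem qPochhammer_succ {R : Type*} [CommRing R] (q : R) (n : ℕ) :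
    qPochhammer q q (n + 1) = qPochhammer q q n * (1 - q ^ (n + 1)) := by
  rw [qPochhammer, Finset.prod_range_succ, ← qPochhammer, pow_succ']

/-- Both sides are inverses of the same denominator. -/
theorem one_sub_mul_recipDenom_succ_left (n₁ n₂ : ℕ) :
    (1 - (X : ℤ⟦X⟧) ^ (n₁ + 1)) * recipDenom (n₁ + 1) n₂ = recipDenom n₁ n₂ := by
  have h := denom_mul_recipDenom (n₁ + 1) n₂
  have h' := denom_mul_recipDenom n₁ n₂
  rw [qPochhammer_succ] at h
  linear_combination recipDenom n₁ n₂ * h -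
    (1 - (X : ℤ⟦X⟧) ^ (n₁ + 1)) * recipDenom (n₁ + 1) n₂ * h'

theorem one_sub_mul_recipDenom_succ_right (n₁ n₂ : ℕ) :
    (1 - ((X : ℤ⟦X⟧) ^ 3) ^ (n₂ + 1)) * recipDenom n₁ (n₂ + 1) = recipDenom n₁ n₂ := by
  have h := denom_mul_recipDenom n₁ (n₂ + 1)
  have h' := denom_mul_recipDenom n₁ n₂
  rw [qPochhammer_succ] at h
  linear_combination recipDenom n₁ n₂ * h -
    (1 - ((X : ℤ⟦X⟧) ^ 3) ^ (n₂ + 1)) * recipDenom n₁ (n₂ + 1) * h'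

/-- The exponent of `q` in the double sums, with linear part `a n₁ + b n₂`. -/
def expo (a b n₁ n₂ : ℕ) : ℕ := n₁ ^ 2 + 3 * n₂ ^ 2 + 3 * n₁ * n₂ + a * n₁ + b * n₂

/-- The summand with index `n₂ = k` in the coefficient of `x ^ m`. -/
noncomputable def coeffTerm (a b m k : ℕ) : ℤ⟦X⟧ :=
  if 2 * k ≤ m then X ^ expo a b (m - 2 * k) k * recipDenom (m - 2 * k) k else 0

/-- The double sum whose exponent of `q` has linear part `a n₁ + b n₂`. -/
noncomputable def doubleSum (a b : ℕ) : ℤ⟦X⟧⟦X⟧ :=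
  PowerSeries.mk fun m => ∑ k ∈ Finset.range (m + 1), coeffTerm a b m k

theorem coeff_doubleSum (a b m : ℕ) :
    (doubleSum a b).coeff m = ∑ k ∈ Finset.range (m + 1), coeffTerm a b m k := by
  simp [doubleSum]

theorem hasSum_typeISummand (a b : ℕ) :
    HasSum (fun n : ℕ × ℕ => typeISummand (expo a b n.1 n.2) n.1 n.2) (doubleSum a b) := by
  rw [PowerSeries.WithPiTopology.hasSum_iff_hasSum_coeff]
  intro m
  have hc : ∀ n : ℕ × ℕ, (typeISummand (expo a b n.1 n.2) n.1 n.2).coeff m =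
      if m = n.1 + 2 * n.2 then X ^ expo a b n.1 n.2 * recipDenom n.1 n.2 else 0 := by
    intro n
    rw [typeISummand, PowerSeries.coeff_C_mul, PowerSeries.coeff_X_pow, mul_ite, mul_one, mul_zero]
  simp only [hc]
  have hsum : (doubleSum a b).coeff m =
      ∑ n ∈ (Finset.range (m + 1) ×ˢ Finset.range (m + 1)),
        if m = n.1 + 2 * n.2 then X ^ expo a b n.1 n.2 * recipDenom n.1 n.2 else 0 := by
    rw [coeff_doubleSum, Finset.sum_product_right]
    refine Finset.sum_congr rfl fun k _ => ?_
    rw [Finset.sum_eq_single (m - 2 * k)]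
    · rw [coeffTerm]
      congr 1
      simp only [eq_iff_iff]
      omega
    · intro i _ hi
      rw [if_neg (by omega)]
    · intro h
      simp only [Finset.mem_range] at h
      omega
  rw [hsum]
  refine hasSum_sum_of_ne_finset_zero fun n hn => if_neg fun h => hn ?_
  simp only [Finset.mem_product, Finset.mem_range]
  omega

theorem coeff_zero_doubleSum (a b : ℕ) : (doubleSum a b).coeff 0 = 1 := by
  have h := denom_mul_recipDenom 0 0
  simpa [coeff_doubleSum, coeffTerm, expo, qPochhammer] using h

theorem rescale_doubleSum (a b : ℕ) :
    PowerSeries.rescale ((X : ℤ⟦X⟧) ^ 3) (doubleSum a b) = doubleSum (a + 3) (b + 6) := by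
  ext1 m
  rw [PowerSeries.coeff_rescale, coeff_doubleSum, coeff_doubleSum, Finset.mul_sum]
  refine Finset.sum_congr rfl fun k _ => ?_
  rw [coeffTerm, coeffTerm, mul_ite, mul_zero]
  split_ifs with h
  · obtain ⟨n, rfl⟩ := Nat.exists_eq_add_of_le h
    rw [Nat.add_sub_cancel_left, ← mul_assoc, ← pow_mul, ← pow_add]
    congr 2
    simp only [expo]; ring
  · rfl

/-- Write 1 = q^{n₁} + (1 - q^{n₁}); the second term cancels the last factor of (q;q)_{n₁}, and n₁
is then shifted by one. -/
theorem doubleSum_contiguous_left (a b : ℕ) : doubleSum a b = doubleSum (a + 1) b +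
    PowerSeries.C ((X : ℤ⟦X⟧) ^ (a + 1)) * X * doubleSum (a + 2) (b + 3) := by
  ext1 m
  rw [map_add, mul_assoc, PowerSeries.coeff_C_mul]
  cases m with
  | zero => simp [coeff_zero_doubleSum]
  | succ m =>
    rw [PowerSeries.coeff_succ_X_mul, coeff_doubleSum, coeff_doubleSum, coeff_doubleSum,
      Finset.mul_sum, ← sub_eq_iff_eq_add', ← Finset.sum_sub_distrib, Finset.sum_range_succ]
    have hlast : coeffTerm a b (m + 1) (m + 1) - coeffTerm (a + 1) b (m + 1) (m + 1) = 0 := by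
      rw [coeffTerm, coeffTerm, if_neg (by omega), if_neg (by omega), sub_zero]
    rw [hlast, add_zero]
    refine Finset.sum_congr rfl fun k _ => ?_
    simp only [coeffTerm]
    rcases lt_trichotomy (2 * k) (m + 1) with h | h | h
    · obtain ⟨n, rfl⟩ := Nat.exists_eq_add_of_le (Nat.lt_succ_iff.mp h)
      rw [if_pos (by omega), if_pos (by omega), if_pos (by omega),
        show 2 * k + n + 1 - 2 * k = n + 1 by omega, Nat.add_sub_cancel_left,
        ← one_sub_mul_recipDenom_succ_left n k]
      simp only [expo]
      ring
    -- Here n₁ = 0, where the factor 1 - q^{n₁} vanishes.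
    · rw [if_pos h.le, if_pos h.le, if_neg (by omega), h, Nat.sub_self]
      simp [expo]
    · rw [if_neg (by omega), if_neg (by omega), if_neg (by omega)]
      simp

/-- The same argument with 1 = q^{3n₂} + (1 - q^{3n₂}), cancelling in (q^3;q^3)_{n₂} and shifting
n₂. -/
theorem doubleSum_contiguous_right (a b : ℕ) : doubleSum a b = doubleSum a (b + 3) +
    PowerSeries.C ((X : ℤ⟦X⟧) ^ (b + 3)) * X ^ 2 * doubleSum (a + 3) (b + 6) := by
  ext1 m
  rw [map_add, mul_assoc, PowerSeries.coeff_C_mul, PowerSeries.coeff_X_pow_mul']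
  split_ifs with hm
  · obtain ⟨m, rfl⟩ := Nat.exists_eq_add_of_le' hm
    rw [Nat.add_sub_cancel, coeff_doubleSum, coeff_doubleSum, coeff_doubleSum,
      Finset.mul_sum, ← sub_eq_iff_eq_add', ← Finset.sum_sub_distrib, Finset.sum_range_succ,
      Finset.sum_range_succ']
    have hlast : coeffTerm a b (m + 2) (m + 2) - coeffTerm a (b + 3) (m + 2) (m + 2) = 0 := by
      rw [coeffTerm, coeffTerm, if_neg (by omega), if_neg (by omega), sub_zero]
    have hzero : coeffTerm a b (m + 2) 0 - coeffTerm a (b + 3) (m + 2) 0 = 0 := by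
      simp [coeffTerm, expo]
    rw [hlast, hzero, add_zero, add_zero]
    refine Finset.sum_congr rfl fun k _ => ?_
    simp only [coeffTerm]
    rcases le_or_gt (2 * k) m with h | h
    · obtain ⟨n, rfl⟩ := Nat.exists_eq_add_of_le h
      rw [if_pos (by omega), if_pos (by omega), if_pos (by omega),
        show 2 * k + n + 2 - 2 * (k + 1) = n by omega, Nat.add_sub_cancel_left,
        ← one_sub_mul_recipDenom_succ_right n k]
      simp only [expo]
      ring
    · rw [if_neg (by omega), if_neg (by omega), if_neg (by omega)]
      simp
  · rw [mul_zero, add_zero, coeff_doubleSum, coeff_doubleSum]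
    refine Finset.sum_congr rfl fun k _ => ?_
    simp only [coeffTerm]
    split_ifs with h
    · obtain rfl : k = 0 := by omega
      simp [expo]
    · rfl

/-! ### The `q`-difference system -/

/-- The system of `q`-difference equations satisfied by the generating functions of type I. -/
structure IsSolution (f g h : ℤ⟦X⟧⟦X⟧) : Prop where
  eq_one : f = g + (PowerSeries.C ((X : ℤ⟦X⟧) ^ 1) * X * PowerSeries.rescale (X ^ 3) f +
    (PowerSeries.C ((X : ℤ⟦X⟧) ^ 1) * X *
      (PowerSeries.C ((X : ℤ⟦X⟧) ^ 3) * X * PowerSeries.rescale (X ^ 3) g) +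
    PowerSeries.C ((X : ℤ⟦X⟧) ^ 1) * X *
      (PowerSeries.C ((X : ℤ⟦X⟧) ^ 2) * X * PowerSeries.rescale (X ^ 3) f)))
  eq_two : g = h + PowerSeries.C ((X : ℤ⟦X⟧) ^ 2) * X * PowerSeries.rescale (X ^ 3) f
  eq_three : h = PowerSeries.rescale (X ^ 3) f +
    (PowerSeries.C ((X : ℤ⟦X⟧) ^ 3) * X * PowerSeries.rescale (X ^ 3) g +
    PowerSeries.C ((X : ℤ⟦X⟧) ^ 3) * X *
      (PowerSeries.C ((X : ℤ⟦X⟧) ^ 3) * X * PowerSeries.rescale (X ^ 3) h))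

theorem IsSolution.sub {f g h f' g' h' : ℤ⟦X⟧⟦X⟧} (H : IsSolution f g h)
    (H' : IsSolution f' g' h') : IsSolution (f - f') (g - g') (h - h') where
  eq_one := by
    simp only [map_sub]
    linear_combination H.eq_one - H'.eq_one
  eq_two := by
    simp only [map_sub]
    linear_combination H.eq_two - H'.eq_two
  eq_three := by
    simp only [map_sub]
    linear_combination H.eq_three - H'.eq_three

/-! ### Uniqueness of solutions of the system -/

theorem X_pow_dvd_rescale {R : Type*} [CommRing R] {c : R} {f : R⟦X⟧} {m : ℕ}
    (h : (X : R⟦X⟧) ^ m ∣ f) : (X : R⟦X⟧) ^ m ∣ PowerSeries.rescale c f := by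
  rw [PowerSeries.X_pow_dvd_iff] at h ⊢
  intro k hk
  rw [PowerSeries.coeff_rescale, h k hk, mul_zero]

theorem coeff_C_mul_X_mul_eq_zero {R : Type*} [CommRing R] {c : R} {f : R⟦X⟧} {m : ℕ}
    (h : (X : R⟦X⟧) ^ m ∣ f) : (PowerSeries.C c * X * f).coeff m = 0 := by
  obtain ⟨f, rfl⟩ := h
  rw [show PowerSeries.C c * X * (X ^ m * f) = X ^ (m + 1) * (PowerSeries.C c * f) by ring,
    PowerSeries.coeff_X_pow_mul', if_neg (by omega)]

theorem IsSolution.X_pow_dvd {f g h : ℤ⟦X⟧⟦X⟧} (H : IsSolution f g h) (hf : f.coeff 0 = 0)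
    (hg : g.coeff 0 = 0) (hh : h.coeff 0 = 0) (m : ℕ) :
    (X : ℤ⟦X⟧⟦X⟧) ^ m ∣ f ∧ (X : ℤ⟦X⟧⟦X⟧) ^ m ∣ g ∧ (X : ℤ⟦X⟧⟦X⟧) ^ m ∣ h := by
  induction m with
  | zero => simp
  | succ m ih =>
    obtain ⟨f0, g0, h0⟩ := ih
    have hf' := X_pow_dvd_rescale (c := (X : ℤ⟦X⟧) ^ 3) f0
    have hg' := X_pow_dvd_rescale (c := (X : ℤ⟦X⟧) ^ 3) g0
    have hh' := X_pow_dvd_rescale (c := (X : ℤ⟦X⟧) ^ 3) h0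
    have hfg := congrArg (PowerSeries.coeff m) H.eq_one
    have hgh := congrArg (PowerSeries.coeff m) H.eq_two
    have hhf := congrArg (PowerSeries.coeff m) H.eq_three
    simp only [map_add, coeff_C_mul_X_mul_eq_zero hf', coeff_C_mul_X_mul_eq_zero hg',
      coeff_C_mul_X_mul_eq_zero (hf'.mul_left _), coeff_C_mul_X_mul_eq_zero (hg'.mul_left _),
      coeff_C_mul_X_mul_eq_zero (hh'.mul_left _), add_zero, PowerSeries.coeff_rescale]
      at hfg hgh hhf
    have key : f.coeff m = 0 ∧ g.coeff m = 0 ∧ h.coeff m = 0 := by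
      rcases Nat.eq_zero_or_pos m with rfl | hm
      · exact ⟨hf, hg, hh⟩
      · have hne : (1 - ((X : ℤ⟦X⟧) ^ 3) ^ m) ≠ 0 := by
          intro h
          have := congrArg PowerSeries.constantCoeff h
          simp [hm.ne'] at this
        -- Every term carrying an explicit x has vanished at x^m, leaving f_m = g_m, g_m = h_m and
        -- h_m = q^{3m} f_m.
        have : (1 - ((X : ℤ⟦X⟧) ^ 3) ^ m) * f.coeff m = 0 := by
          linear_combination hfg + hgh + hhf
        have hf0 := (mul_eq_zero.mp this).resolve_left hne
        exact ⟨hf0, hfg ▸ hf0, hgh ▸ hfg ▸ hf0⟩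
    simp only [PowerSeries.X_pow_dvd_iff, Nat.lt_succ_iff_lt_or_eq] at f0 g0 h0 ⊢
    exact ⟨fun k hk => hk.elim (f0 k) fun e => e ▸ key.1,
      fun k hk => hk.elim (g0 k) fun e => e ▸ key.2.1,
      fun k hk => hk.elim (h0 k) fun e => e ▸ key.2.2⟩

theorem eq_zero_of_forall_X_pow_dvd {R : Type*} [CommRing R] {f : R⟦X⟧}
    (h : ∀ m, (X : R⟦X⟧) ^ m ∣ f) : f = 0 := by
  ext m
  exact PowerSeries.X_pow_dvd_iff.mp (h (m + 1)) m m.lt_succ_self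

theorem IsSolution.unique {f g h f' g' h' : ℤ⟦X⟧⟦X⟧} (H : IsSolution f g h)
    (H' : IsSolution f' g' h') (hf : f.coeff 0 = f'.coeff 0) (hg : g.coeff 0 = g'.coeff 0)
    (hh : h.coeff 0 = h'.coeff 0) : f = f' ∧ g = g' ∧ h = h' := by
  have key := (H.sub H').X_pow_dvd (by rw [map_sub, hf, sub_self]) (by rw [map_sub, hg, sub_self])
    (by rw [map_sub, hh, sub_self])
  exact ⟨sub_eq_zero.mp (eq_zero_of_forall_X_pow_dvd fun m => (key m).1),
    sub_eq_zero.mp (eq_zero_of_forall_X_pow_dvd fun m => (key m).2.1),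
    sub_eq_zero.mp (eq_zero_of_forall_X_pow_dvd fun m => (key m).2.2)⟩

/-! ### The double sums solve the system -/

theorem isSolution_doubleSum : IsSolution (doubleSum 0 0) (doubleSum 1 3) (doubleSum 2 3) := by
  have e₁ := doubleSum_contiguous_left 0 0
  have e₂ := doubleSum_contiguous_right 1 0
  have e₃ := doubleSum_contiguous_left 3 6
  have e₄ := doubleSum_contiguous_left 1 3
  have e₅ := doubleSum_contiguous_left 2 3
  have e₆ := doubleSum_contiguous_right 3 3
  have e₇ := doubleSum_contiguous_right 4 6
  have e₈ := doubleSum_contiguous_left 5 9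
  have h₃ : doubleSum 2 3 = doubleSum 3 6 +
      (PowerSeries.C ((X : ℤ⟦X⟧) ^ 3) * X * doubleSum 4 9 + PowerSeries.C ((X : ℤ⟦X⟧) ^ 3) * X *
        (PowerSeries.C ((X : ℤ⟦X⟧) ^ 3) * X * doubleSum 5 9)) := by
    simp only [map_pow, Nat.reduceAdd] at *
    -- Expand S(2,3) and then S(3,3) and S(4,6); the terms in S(6,9) and S(7,12) recombine into
    -- S(5,9) by `e₈`.
    linear_combination e₅ + e₆ + PowerSeries.C X ^ 3 * X * e₇ - PowerSeries.C X ^ 6 * X ^ 2 * e₈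
  constructor
  · simp only [rescale_doubleSum]
    simp only [map_pow, Nat.reduceAdd] at *
    -- Substituting `h₃` for S(2,3) leaves x^2q^3 (S(4,6) + xq^4 S(5,9)), which is x^2q^3 S(3,6) by
    -- `e₃`.
    linear_combination e₁ + e₂ - PowerSeries.C X ^ 3 * X ^ 2 * e₃ + PowerSeries.C X * X * h₃
  · simpa only [rescale_doubleSum, Nat.reduceAdd] using e₄
  · simpa only [rescale_doubleSum, Nat.reduceAdd] using h₃

end TypeISeries

open ListGenFun TypeIList TypeISeries in
theorem isSolution_listGenFun : IsSolution (listGenFun (typeIList 1))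
    (listGenFun (typeIList 2)) (listGenFun (typeIList 3)) where
  eq_one := by
    simpa only [← listGenFun_typeIList_add_three] using listGenFun_typeIList_one
  eq_two := by
    simpa only [← listGenFun_typeIList_add_three] using listGenFun_typeIList_two
  eq_three := by
    simpa only [← listGenFun_typeIList_add_three] using listGenFun_typeIList_three

open TypeIList TypeISeries in
theorem mainTheorem1 :
    HasSum (fun n : ℕ × ℕ =>
        typeISummand (n.1 ^ 2 + 3 * n.2 ^ 2 + 3 * n.1 * n.2) n.1 n.2)
      (IntPartition.genFun (IntPartition.typeI 1)) ∧
    HasSum (fun n : ℕ × ℕ =>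
        typeISummand (n.1 ^ 2 + 3 * n.2 ^ 2 + 3 * n.1 * n.2 + n.1 + 3 * n.2) n.1 n.2)
      (IntPartition.genFun (IntPartition.typeI 2)) ∧
    HasSum (fun n : ℕ × ℕ =>
        typeISummand (n.1 ^ 2 + 3 * n.2 ^ 2 + 3 * n.1 * n.2 + 2 * n.1 + 3 * n.2) n.1 n.2)
      (IntPartition.genFun (IntPartition.typeI 3)) := by
  obtain ⟨h₁, h₂, h₃⟩ := isSolution_listGenFun.unique isSolution_doubleSum
    (by rw [coeff_zero_listGenFun_typeIList, coeff_zero_doubleSum])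
    (by rw [coeff_zero_listGenFun_typeIList, coeff_zero_doubleSum])
    (by rw [coeff_zero_listGenFun_typeIList, coeff_zero_doubleSum])
  rw [genFun_typeI one_pos, genFun_typeI two_pos, genFun_typeI three_pos, h₁, h₂, h₃]
  refine ⟨?_, ?_, ?_⟩
  · simpa [expo] using hasSum_typeISummand 0 0
  · simpa [expo] using hasSum_typeISummand 1 3
  · simpa [expo] using hasSum_typeISummand 2 3
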